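/- Let $\Delta$ be the root system of a simple Lie algebra (a reduced irreducible crystallographic root system), spanning the $\mathbb Q$-vector space $V$, with simple roots $\Pi$, positive roots $\Delta^+$, highest root $\theta$, Weyl group $W$, and a $W$-invariant inner product $(\ ,\ )$ on $V$. Let $\widehat V=V\oplus\mathbb Q\delta\oplus\mathbb Q\Lambda$, with the inner product extended to a symmetric bilinear form by $(\delta,V)=(\Lambda,V)=(\delta,\delta)=(\Lambda,\Lambda)=0$ and $(\delta,\Lambda)=1$. Let $\widehat\Delta=\{\alpha+k\delta\mid \alpha\in\Delta,\ k\in\mathbb Z\}$ be the affine real roots, $\widehat\Delta^+=\Delta^+\cup\{\alpha+k\delta\mid\alpha\in\Delta,\ k\ge 1\}$ the positive ones, $\widehat\Pi=\Pi\cup\{\delta-\theta\}$ the affine simple roots, and let $\widehat W\subset GL(\widehat V)$ be the affine Weyl group, generated by the reflections in the affine real roots. A subset $I\subset\Delta^+$ is an Abelian ideal if (a) $\mu+\nu\notin\Delta$ for all $\mu,\nu\in I$, and (b) $\gamma+\nu\in I$ whenever $\gamma\in I$, $\nu\in\Delta^+$ and $\gamma+\nu\in\Delta$. An element $\gamma\in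 I$ is a generator of $I$ if $\gamma-\alpha\notin I$ for all $\alpha\in\Delta^+$. For $w\in\widehat W$ put $\widehat N(w)=\{\alpha\in\widehat\Delta^+\mid w(\alpha)\in-\widehat\Delta^+\}$. The element $w$ is minuscule if $\widehat N(w)=\{\delta-\gamma\mid\gamma\in I\}$ for some $I\subset\Delta^+$; in that case put $I_w=\{\gamma\in\Delta^+\mid\delta-\gamma\in\widehat N(w)\}$, which is an Abelian ideal by a result of Peterson. Theorem. Let $w\in\widehat W$ be minuscule. (1) If $\gamma\in I_w$, then $\gamma$ is a generator of $I_w$ if and only if $w(\delta-\gamma)\in-\widehat\Pi$. (2) If $\gamma\in\Delta^+\setminus I_w$, then $I_w\cup\{\gamma\}$ is an Abelian ideal if and only if $w(\delta-\gamma)\in\widehat\Pi$. -/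

import Mathlib

open scoped Pointwise

noncomputable section

namespace AffineRoots

variable {ι V N : Type*} [AddCommGroup V] [Module ℚ V] [AddCommGroup N] [Module ℚ N]
variable {P : RootPairing ι ℚ V N}

/-- The set `Δ` of roots, as a subset of `V`. -/
def roots (P : RootPairing ι ℚ V N) : Set V :=
  Set.range P.root

/-- The set `Π` of simple roots, as a subset of `V`. -/
def simpleRoots (b : P.Base) : Set V :=
  P.root '' b.support

/-- The set `Δ⁺` of positive roots, as a subset of `V`: the roots that are sums of simple roots. -/
def posRoots (b : P.Base) : Set V :=
  {v | v ∈ roots P ∧ v ∈ AddSubmonoid.closure (simpleRoots b)}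

/-- `θ` is the highest root: it is a root, and for every root `α` the difference `θ - α` is a
sum of simple roots. -/
def IsHighestRoot (b : P.Base) (θ : V) : Prop :=
  θ ∈ roots P ∧ ∀ α ∈ roots P, θ - α ∈ AddSubmonoid.closure (simpleRoots b)

/-- A (combinatorial) Abelian ideal. -/
structure IsAbelianIdeal (b : P.Base) (I : Set V) : Prop where
  subset : I ⊆ posRoots b
  abelian : ∀ μ ∈ I, ∀ ν ∈ I, μ + ν ∉ roots P
  ideal : ∀ γ ∈ I, ∀ ν ∈ posRoots b, γ + ν ∈ roots P → γ + ν ∈ I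

/-- `γ` is a generator of `I`. -/
def IsGenerator (b : P.Base) (I : Set V) (γ : V) : Prop :=
  γ ∈ I ∧ ∀ α ∈ posRoots b, γ - α ∉ I

/-- The space `V̂ = V ⊕ ℚ δ ⊕ ℚ Λ`; the triple `(v, k, m)` stands for `v + k δ + m Λ`. -/
abbrev AffineSpan (V : Type*) : Type _ := V × ℚ × ℚ

/-- The inclusion of `V` into `V̂`. -/
def incl : V →ₗ[ℚ] AffineSpan V :=
  LinearMap.inl ℚ V (ℚ × ℚ)

/-- The vector `δ` of `V̂`. -/
def imagRoot : AffineSpan V :=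
  (0, 1, 0)

/-- The extension to `V̂` of a bilinear form on `V`, with
`(δ, V) = (Λ, V) = (δ, δ) = (Λ, Λ) = 0` and `(δ, Λ) = (Λ, δ) = 1`. -/
def affineForm (B : LinearMap.BilinForm ℚ V) : LinearMap.BilinForm ℚ (AffineSpan V) :=
  LinearMap.mk₂ ℚ (fun x y => B x.1 y.1 + x.2.1 * y.2.2 + x.2.2 * y.2.1)
    (fun x x' y => by simp; ring) (fun c x y => by simp; ring)
    (fun x y y' => by simp; ring) (fun c x y => by simp; ring)

/-- The set `Δ̂ = {α + k δ | α ∈ Δ, k ∈ ℤ}` of affine real roots. -/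
def affineRoots (P : RootPairing ι ℚ V N) : Set (AffineSpan V) :=
  {x | ∃ α ∈ roots P, ∃ k : ℤ, x = incl α + (k : ℚ) • imagRoot}

/-- The set `Δ̂⁺ = Δ⁺ ∪ {α + k δ | α ∈ Δ, k ≥ 1}` of positive affine roots. -/
def affinePosRoots (b : P.Base) : Set (AffineSpan V) :=
  incl '' posRoots b ∪
    {x | ∃ α ∈ roots P, ∃ k : ℤ, 1 ≤ k ∧ x = incl α + (k : ℚ) • imagRoot}

/-- The set `Π̂ = Π ∪ {δ - θ}` of affine simple roots. -/
def affineSimpleRoots (b : P.Base) (θ : V) : Set (AffineSpan V) :=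
  incl '' simpleRoots b ∪ {imagRoot - incl θ}

/-- The orthogonal reflection `x ↦ x - (2 (a, x) / (a, a)) a` of `V̂` in a non-isotropic
vector `a`. -/
def affineReflection (B : LinearMap.BilinForm ℚ V) (a : AffineSpan V)
    (ha : affineForm B a a ≠ 0) : AffineSpan V ≃ₗ[ℚ] AffineSpan V :=
  Module.reflection (x := a) (f := (2 / affineForm B a a) • affineForm B a)
    (by simp [div_mul_cancel₀ _ ha])

/-- The affine Weyl group `Ŵ`: the group of linear automorphisms of `V̂` generated by the
reflections in the affine real roots. -/
def affineWeylGroup (P : RootPairing ι ℚ V N) (B : LinearMap.BilinForm ℚ V) :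
    Subgroup (AffineSpan V ≃ₗ[ℚ] AffineSpan V) :=
  Subgroup.closure
    {s | ∃ a ∈ affineRoots P, ∃ ha : affineForm B a a ≠ 0, s = affineReflection B a ha}

/-- The set `N̂(w)` of positive affine roots that `w` makes negative. -/
def inversionSet (b : P.Base) (w : AffineSpan V ≃ₗ[ℚ] AffineSpan V) : Set (AffineSpan V) :=
  {a | a ∈ affinePosRoots b ∧ w a ∈ -affinePosRoots b}

/-- `w` is minuscule: `N̂(w) = {δ - γ | γ ∈ I}` for some set `I` of positive roots. -/
def IsMinuscule (b : P.Base) (w : AffineSpan V ≃ₗ[ℚ] AffineSpan V) : Prop :=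
  ∃ I ⊆ posRoots b, inversionSet b w = (fun γ => imagRoot - incl γ) '' I

/-- The set `I_w = {γ ∈ Δ⁺ | δ - γ ∈ N̂(w)}`. -/
def idealOf (b : P.Base) (w : AffineSpan V ≃ₗ[ℚ] AffineSpan V) : Set V :=
  {γ | γ ∈ posRoots b ∧ imagRoot - incl γ ∈ inversionSet b w}

end AffineRoots

end

noncomputable section

namespace AffineRoots

variable {ι V N : Type*} [AddCommGroup V] [Module ℚ V] [AddCommGroup N] [Module ℚ N]
variable {P : RootPairing ι ℚ V N}

/-! ### Positive roots of the finite root system -/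

/-! Simplicity is indecomposability. A simple affine root is never a sum of two positive real roots
(`add_notMem_affineSimpleRoots`), while a positive real root that is not simple splits as a positive
real root plus either another one or a positive multiple of δ
(`exists_add_of_notMem_affineSimpleRoots`).

The element `w` fixes δ and permutes the real roots, so splittings of ±w(δ - γ) correspond to
splittings of ±(δ - γ) into real roots whose images are positive. Since `w` is minuscule, the only
positive real roots it makes negative are the δ - γ' with γ' in the ideal. In particular, they all
have δ-coefficient 1. Comparing coefficients, a splitting exhibits either a smaller element of the
ideal below γ, or a failure of the Abelian or the ideal condition after adding γ. Conversely, each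
such configuration writes ±w(δ - γ) as a sum of two positive real roots. -/

lemma neg_mem_roots {α : V} (h : α ∈ roots P) : -α ∈ roots P := by
  obtain ⟨i, rfl⟩ := h
  exact ⟨P.reflectionPerm i i, by simp⟩

lemma neg_mem_roots_iff {α : V} : -α ∈ roots P ↔ α ∈ roots P :=
  ⟨fun h => by simpa using neg_mem_roots h, neg_mem_roots⟩

lemma ne_zero_of_mem_roots {α : V} (h : α ∈ roots P) : α ≠ 0 := by
  obtain ⟨i, rfl⟩ := h
  exact P.ne_zero i

lemma simpleRoots_subset_posRoots (b : P.Base) : simpleRoots b ⊆ posRoots b := by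
  rintro _ ⟨i, hi, rfl⟩
  exact ⟨⟨i, rfl⟩, AddSubmonoid.subset_closure ⟨i, hi, rfl⟩⟩

lemma mem_posRoots_or_neg_mem (b : P.Base) {α : V} (h : α ∈ roots P) :
    α ∈ posRoots b ∨ -α ∈ posRoots b := by
  obtain ⟨i, rfl⟩ := h
  exact (b.root_mem_or_neg_mem i).imp (fun h => ⟨⟨i, rfl⟩, h⟩)
    (fun h => ⟨neg_mem_roots ⟨i, rfl⟩, h⟩)

lemma add_mem_posRoots {b : P.Base} {α β : V} (hα : α ∈ posRoots b) (hβ : β ∈ posRoots b)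
    (h : α + β ∈ roots P) : α + β ∈ posRoots b :=
  ⟨h, add_mem hα.2 hβ.2⟩

/-- There is a linear functional which is `1` on all simple roots. -/
lemma exists_height (b : P.Base) : ∃ h : V →ₗ[ℚ] ℚ, ∀ α ∈ simpleRoots b, h α = 1 := by
  have hli : LinearIndepOn ℚ id (simpleRoots b) := b.linearIndepOn_root.id_image
  let e := Module.Basis.extend hli
  refine ⟨e.constr ℚ fun _ => 1, fun α hα => ?_⟩
  have := e.constr_basis ℚ (fun _ => (1 : ℚ)) ⟨α, hli.subset_extend _ hα⟩
  simpa [e] using this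

/-- A sum of simple roots has natural height, and vanishes if its height does. -/
lemma height_closure {b : P.Base} {h : V →ₗ[ℚ] ℚ} (hh : ∀ α ∈ simpleRoots b, h α = 1) {x : V}
    (hx : x ∈ AddSubmonoid.closure (simpleRoots b)) : x = 0 ∨ 1 ≤ h x := by
  induction hx using AddSubmonoid.closure_induction with
  | mem x hx => exact Or.inr (hh x hx).ge
  | zero => exact Or.inl rfl
  | add x y _ _ hx hy =>
    rcases hx with rfl | hx
    · simpa using hy
    · rcases hy with rfl | hy
      · simpa using Or.inr hx
      · exact Or.inr (by rw [map_add]; linarith)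

lemma neg_notMem_closure {b : P.Base} {x : V} (hx : x ∈ posRoots b) :
    -x ∉ AddSubmonoid.closure (simpleRoots b) := by
  intro hn
  obtain ⟨h, hh⟩ := exists_height b
  have h0 := ne_zero_of_mem_roots hx.1
  have h1 := (height_closure hh hx.2).resolve_left h0
  have h2 := (height_closure hh hn).resolve_left (neg_ne_zero.2 h0)
  rw [map_neg] at h2
  linarith

lemma neg_notMem_posRoots {b : P.Base} {x : V} (hx : x ∈ posRoots b) : -x ∉ posRoots b :=
  fun h => neg_notMem_closure hx h.2

lemma add_notMem_simpleRoots {b : P.Base} {α β : V} (hα : α ∈ posRoots b)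
    (hβ : β ∈ posRoots b) : α + β ∉ simpleRoots b := by
  intro hs
  obtain ⟨h, hh⟩ := exists_height b
  have h1 := (height_closure hh hα.2).resolve_left (ne_zero_of_mem_roots hα.1)
  have h2 := (height_closure hh hβ.2).resolve_left (ne_zero_of_mem_roots hβ.1)
  have h3 := hh _ hs
  rw [map_add] at h3
  linarith

/-! ### Splitting and raising positive roots by means of the invariant form -/

section Finite

variable [Finite ι] [P.IsCrystallographic]

/-- Since 2(α, β) is the pairing times (β, β), the pairing is positive as well, and the root string
through α then contains α - β. -/
lemma sub_mem_roots_of_form_pos (B : P.InvariantForm) (hB : ∀ x : V, x ≠ 0 → 0 < B.form x x)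
    {α β : V} (hα : α ∈ roots P) (hβ : β ∈ roots P) (hne : α ≠ β) (h : 0 < B.form α β) :
    α - β ∈ roots P := by
  obtain ⟨i, rfl⟩ := hα
  obtain ⟨j, rfl⟩ := hβ
  refine P.root_sub_root_mem_of_pairingIn_pos ?_ (fun hij => hne (by rw [hij]))
  have h1 := B.two_mul_apply_root_root i j
  have h2 := hB _ (P.ne_zero j)
  have h3 : 0 < P.pairing i j := by
    by_contra! hc
    have := mul_nonpos_of_nonpos_of_nonneg hc h2.le
    linarith
  rw [← P.algebraMap_pairingIn ℤ] at h3
  simpa using h3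

/-- A positive root which is not simple is a sum of two positive roots. -/
lemma exists_add_of_notMem_simpleRoots {b : P.Base} (B : P.InvariantForm)
    (hB : ∀ x : V, x ≠ 0 → 0 < B.form x x) {α : V} (hα : α ∈ posRoots b)
    (hs : α ∉ simpleRoots b) : ∃ β ∈ posRoots b, ∃ γ ∈ posRoots b, α = β + γ := by
  -- Otherwise (α, ·) is nonpositive on all sums of simple roots, including α itself.
  obtain ⟨β, hβ, hpos⟩ : ∃ β ∈ simpleRoots b, 0 < B.form α β := by
    by_contra! hc
    have : ∀ x ∈ AddSubmonoid.closure (simpleRoots b), B.form α x ≤ 0 := by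
      intro x hx
      induction hx using AddSubmonoid.closure_induction with
      | mem x hx => exact hc x hx
      | zero => simp
      | add x y _ _ hx hy => rw [map_add]; linarith
    have h1 := this α hα.2
    have h2 := hB α (ne_zero_of_mem_roots hα.1)
    linarith
  have hβ' := simpleRoots_subset_posRoots b hβ
  have hr := sub_mem_roots_of_form_pos B hB hα.1 hβ'.1 (fun h => hs (h ▸ hβ)) hpos
  rcases mem_posRoots_or_neg_mem b hr with h | h
  · exact ⟨_, h, β, hβ', by abel⟩
  · refine absurd hβ ?_
    have := add_notMem_simpleRoots hα h
    rwa [show α + -(α - β) = β by abel] at this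

/-- A positive root other than the highest root can be raised by a positive root. -/
lemma exists_add_mem_roots_of_ne_highest {b : P.Base} (B : P.InvariantForm)
    (hB : ∀ x : V, x ≠ 0 → 0 < B.form x x) {θ : V} (hθ : IsHighestRoot b θ) {μ : V}
    (hμ : μ ∈ posRoots b) (hne : μ ≠ θ) : ∃ ν ∈ posRoots b, μ + ν ∈ roots P := by
  by_cases hc : ∃ β ∈ simpleRoots b, B.form μ β < 0
  · obtain ⟨β, hβ, hneg⟩ := hc
    have hβ' := simpleRoots_subset_posRoots b hβ
    refine ⟨β, hβ', ?_⟩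
    have := sub_mem_roots_of_form_pos B hB hμ.1 (neg_mem_roots hβ'.1)
      (fun h => neg_notMem_posRoots hβ' (h ▸ hμ)) (by rw [map_neg]; linarith)
    simpa using this
  -- Here μ is dominant, so (μ, θ - μ) ≥ 0 and hence (μ, θ) > 0; thus θ - μ is a root and serves as
  -- ν.
  · push Not at hc
    have hnn : ∀ x ∈ AddSubmonoid.closure (simpleRoots b), 0 ≤ B.form μ x := by
      intro x hx
      induction hx using AddSubmonoid.closure_induction with
      | mem x hx => exact hc x hx
      | zero => simp
      | add x y _ _ hx hy => rw [map_add]; linarith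
    have h1 := hnn _ (hθ.2 μ hμ.1)
    have h2 := hB μ (ne_zero_of_mem_roots hμ.1)
    rw [map_sub] at h1
    have hr := sub_mem_roots_of_form_pos B hB hμ.1 hθ.1 hne (by linarith)
    refine ⟨θ - μ, ⟨by simpa using neg_mem_roots hr, hθ.2 μ hμ.1⟩, ?_⟩
    simpa using hθ.1

end Finite

/-! ### Affine roots -/

/-- The vector `v + k δ` of `V̂`. -/
def shift (v : V) (k : ℤ) : AffineSpan V :=
  incl v + (k : ℚ) • imagRoot

lemma shift_eq (v : V) (k : ℤ) : shift v k = (v, (k : ℚ), 0) := by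
  simp [shift, incl, imagRoot]

lemma shift_add (v v' : V) (k k' : ℤ) : shift v k + shift v' k' = shift (v + v') (k + k') := by
  simp [shift_eq]

lemma neg_shift (v : V) (k : ℤ) : -shift v k = shift (-v) (-k) := by
  simp [shift_eq]

lemma shift_inj {v v' : V} {k k' : ℤ} : shift v k = shift v' k' ↔ v = v' ∧ k = k' := by
  simp [shift_eq]

lemma incl_eq_shift (v : V) : incl v = shift v 0 := by
  simp [shift]

lemma imagRoot_sub_incl (v : V) : imagRoot - incl v = shift (-v) 1 := by
  simp [shift_eq, incl, imagRoot]

lemma smul_imagRoot (k : ℤ) : (k : ℚ) • (imagRoot : AffineSpan V) = shift 0 k := by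
  simp [shift]

lemma shift_mem_affineRoots {v : V} {k : ℤ} : shift v k ∈ affineRoots P ↔ v ∈ roots P := by
  constructor
  · rintro ⟨α, hα, m, h⟩
    obtain ⟨rfl, rfl⟩ := shift_inj.1 h
    exact hα
  · exact fun h => ⟨v, h, k, rfl⟩

lemma exists_shift_of_mem_affineRoots {x : AffineSpan V} (h : x ∈ affineRoots P) :
    ∃ α ∈ roots P, ∃ k : ℤ, x = shift α k := h

lemma shift_mem_affinePosRoots {b : P.Base} {v : V} {k : ℤ} :
    shift v k ∈ affinePosRoots b ↔ v ∈ posRoots b ∧ k = 0 ∨ v ∈ roots P ∧ 1 ≤ k := by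
  constructor
  · rintro (⟨α, hα, h⟩ | ⟨α, hα, m, hm, h⟩)
    · rw [incl_eq_shift, shift_inj] at h
      obtain ⟨rfl, rfl⟩ := h
      exact Or.inl ⟨hα, rfl⟩
    · obtain ⟨rfl, rfl⟩ := shift_inj.1 h
      exact Or.inr ⟨hα, hm⟩
  · rintro (⟨h, rfl⟩ | ⟨h, hk⟩)
    · exact Or.inl ⟨v, h, incl_eq_shift v⟩
    · exact Or.inr ⟨v, h, k, hk, rfl⟩

lemma affinePosRoots_subset (b : P.Base) : affinePosRoots b ⊆ affineRoots P := by
  rintro _ (⟨α, hα, rfl⟩ | ⟨α, hα, m, -, rfl⟩)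
  · rw [incl_eq_shift]
    exact shift_mem_affineRoots.2 hα.1
  · exact shift_mem_affineRoots.2 hα

lemma mem_affinePosRoots_or_neg_mem (b : P.Base) {x : AffineSpan V} (h : x ∈ affineRoots P) :
    x ∈ affinePosRoots b ∨ -x ∈ affinePosRoots b := by
  obtain ⟨α, hα, k, rfl⟩ := exists_shift_of_mem_affineRoots h
  rw [neg_shift, shift_mem_affinePosRoots, shift_mem_affinePosRoots, neg_mem_roots_iff]
  rcases lt_trichotomy k 0 with hk | rfl | hk
  · exact Or.inr (Or.inr ⟨hα, by omega⟩)
  · rcases mem_posRoots_or_neg_mem b hα with h | h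
    · exact Or.inl (Or.inl ⟨h, rfl⟩)
    · exact Or.inr (Or.inl ⟨h, rfl⟩)
  · exact Or.inl (Or.inr ⟨hα, by omega⟩)

lemma neg_notMem_affinePosRoots {b : P.Base} {x : AffineSpan V} (h : x ∈ affinePosRoots b) :
    -x ∉ affinePosRoots b := by
  obtain ⟨α, hα, k, rfl⟩ := exists_shift_of_mem_affineRoots (affinePosRoots_subset b h)
  rw [neg_shift]
  rw [shift_mem_affinePosRoots] at h ⊢
  rintro (⟨h1, h2⟩ | ⟨h1, h2⟩)
  · rcases h with ⟨h, -⟩ | ⟨-, h⟩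
    · exact neg_notMem_posRoots h h1
    · omega
  · rcases h with ⟨-, h⟩ | ⟨-, h⟩ <;> omega

lemma add_mem_affinePosRoots {b : P.Base} {x y : AffineSpan V} (hx : x ∈ affinePosRoots b)
    (hy : y ∈ affinePosRoots b) (h : x + y ∈ affineRoots P) : x + y ∈ affinePosRoots b := by
  obtain ⟨α, -, k, rfl⟩ := exists_shift_of_mem_affineRoots (affinePosRoots_subset b hx)
  obtain ⟨β, -, m, rfl⟩ := exists_shift_of_mem_affineRoots (affinePosRoots_subset b hy)
  rw [shift_add] at h ⊢
  rw [shift_mem_affineRoots] at h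
  rw [shift_mem_affinePosRoots] at *
  rcases hx with ⟨hx, rfl⟩ | ⟨hx, hk⟩
  · rcases hy with ⟨hy, rfl⟩ | ⟨hy, hm⟩
    · exact Or.inl ⟨add_mem_posRoots hx hy h, rfl⟩
    · exact Or.inr ⟨h, by omega⟩
  · exact Or.inr ⟨h, by rcases hy with ⟨-, hm⟩ | ⟨-, hm⟩ <;> omega⟩

/-- An affine simple root is not a sum of two positive affine real roots. -/
lemma add_notMem_affineSimpleRoots {b : P.Base} {θ : V} (hθ : IsHighestRoot b θ)
    {x y : AffineSpan V} (hx : x ∈ affinePosRoots b) (hy : y ∈ affinePosRoots b) :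
    x + y ∉ affineSimpleRoots b θ := by
  obtain ⟨α, -, k, rfl⟩ := exists_shift_of_mem_affineRoots (affinePosRoots_subset b hx)
  obtain ⟨β, -, m, rfl⟩ := exists_shift_of_mem_affineRoots (affinePosRoots_subset b hy)
  rw [shift_mem_affinePosRoots] at hx hy
  -- This excludes δ - θ = α + (β + δ): θ + β = -α would be a sum of simple roots.
  have key : ∀ α ∈ posRoots b, ∀ β ∈ roots P, α + β ≠ -θ := by
    intro α hα β hβ h
    have := hθ.2 (-β) (neg_mem_roots hβ)
    rw [show θ - -β = -α by rw [← neg_neg θ, ← h]; abel] at this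
    exact neg_notMem_closure hα this
  rw [shift_add]
  rintro (⟨σ, hσ, h⟩ | h)
  · rw [incl_eq_shift, shift_inj] at h
    obtain ⟨rfl, h⟩ := h
    rcases hx with ⟨hx, rfl⟩ | ⟨-, hx⟩ <;> rcases hy with ⟨hy, rfl⟩ | ⟨-, hy⟩
    · exact add_notMem_simpleRoots hx hy hσ
    all_goals omega
  · rw [Set.mem_singleton_iff, imagRoot_sub_incl, shift_inj] at h
    obtain ⟨h, h'⟩ := h
    rcases hx with ⟨hx, rfl⟩ | ⟨hx, hk⟩ <;> rcases hy with ⟨hy, rfl⟩ | ⟨hy, hm⟩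
    · omega
    · exact key α hx β hy h
    · exact key β hy α hx (by rw [add_comm]; exact h)
    · omega

/-- A positive affine real root which is not simple is the sum of a positive affine real root and
of either another one or a positive multiple of `δ`. -/
lemma exists_add_of_notMem_affineSimpleRoots [Finite ι] [P.IsCrystallographic] {b : P.Base}
    (B : P.InvariantForm) (hB : ∀ x : V, x ≠ 0 → 0 < B.form x x) {θ : V}
    (hθ : IsHighestRoot b θ) {x : AffineSpan V} (hx : x ∈ affinePosRoots b)
    (hs : x ∉ affineSimpleRoots b θ) :
    ∃ y ∈ affinePosRoots b, ∃ z,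
      (z ∈ affinePosRoots b ∨ ∃ k : ℤ, 1 ≤ k ∧ z = shift 0 k) ∧ x = y + z := by
  obtain ⟨α, -, k, rfl⟩ := exists_shift_of_mem_affineRoots (affinePosRoots_subset b hx)
  rw [shift_mem_affinePosRoots] at hx
  rcases hx with ⟨hα, rfl⟩ | ⟨hα, hk⟩
  · obtain ⟨β, hβ, γ, hγ, rfl⟩ := exists_add_of_notMem_simpleRoots B hB hα
      (fun h => hs (Or.inl ⟨α, h, incl_eq_shift α⟩))
    exact ⟨shift β 0, shift_mem_affinePosRoots.2 (Or.inl ⟨hβ, rfl⟩), shift γ 0,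
      Or.inl (shift_mem_affinePosRoots.2 (Or.inl ⟨hγ, rfl⟩)), by simp [shift_add]⟩
  -- If subtracting δ keeps the root positive, δ is split off. Otherwise k = 1 and -α is a positive
  -- root other than θ, which some ν raises; then α + δ = (α - ν + δ) + ν.
  by_cases hp : shift α (k - 1) ∈ affinePosRoots b
  · exact ⟨_, hp, shift 0 1, Or.inr ⟨1, le_rfl, rfl⟩, by simp [shift_add]⟩
  rw [shift_mem_affinePosRoots] at hp
  have hk1 : k = 1 := by
    by_contra hne
    exact hp (Or.inr ⟨hα, by omega⟩)
  subst hk1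
  have hμ : -α ∈ posRoots b :=
    (mem_posRoots_or_neg_mem b hα).resolve_left fun h => hp (Or.inl ⟨h, by norm_num⟩)
  obtain ⟨ν, hν, hr⟩ := exists_add_mem_roots_of_ne_highest B hB hθ hμ fun h =>
    hs (Or.inr (by rw [Set.mem_singleton_iff, imagRoot_sub_incl, ← h, neg_neg]))
  refine ⟨shift (α - ν) 1, shift_mem_affinePosRoots.2 (Or.inr ⟨?_, le_rfl⟩), shift ν 0,
    Or.inl (shift_mem_affinePosRoots.2 (Or.inl ⟨hν, rfl⟩)), by simp [shift_add]⟩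
  rw [← neg_mem_roots_iff, neg_sub, sub_eq_neg_add]
  exact hr

/-! ### The action of the affine Weyl group -/

lemma affineReflection_shift_root [P.IsCrystallographic] (B : P.InvariantForm) (i j : ι)
    (k m : ℤ) (ha : affineForm B.form (shift (P.root i) k) (shift (P.root i) k) ≠ 0) :
    affineReflection B.form (shift (P.root i) k) ha (shift (P.root j) m) =
      shift (P.root (P.reflectionPerm i j)) (m - P.pairingIn ℤ j i * k) := by
  have h1 := B.two_mul_apply_root_root j i
  have h2 : (P.pairingIn ℤ j i : ℚ) = P.pairing j i := by
    simpa using P.algebraMap_pairingIn ℤ j i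
  have h3 : B.form (P.root i) (P.root j) = B.form (P.root j) (P.root i) := by
    simpa using B.symm.eq (P.root i) (P.root j)
  have h4 : 2 / B.form (P.root i) (P.root i) * B.form (P.root i) (P.root j) = P.pairing j i := by
    have := B.ne_zero i
    rw [h3]
    field_simp
    linarith
  simp [affineReflection, Module.reflection_apply, affineForm, shift_eq, h4, h2,
    P.root_reflectionPerm, P.reflection_apply_root]

lemma affineReflection_imagRoot (B : LinearMap.BilinForm ℚ V) (v : V) (k : ℤ)
    (ha : affineForm B (shift v k) (shift v k) ≠ 0) :
    affineReflection B (shift v k) ha imagRoot = imagRoot := by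
  simp [affineReflection, Module.reflection_apply, affineForm, shift_eq, imagRoot]

lemma map_imagRoot {B : LinearMap.BilinForm ℚ V} {w : AffineSpan V ≃ₗ[ℚ] AffineSpan V}
    (hw : w ∈ affineWeylGroup P B) : w imagRoot = imagRoot := by
  induction hw using Subgroup.closure_induction with
  | mem s hs =>
    obtain ⟨_, ⟨α, -, k, rfl⟩, ha, rfl⟩ := hs
    exact affineReflection_imagRoot B α k ha
  | one => rfl
  | mul x y _ _ hx hy => rw [LinearEquiv.mul_apply, hy, hx]
  | inv x _ hx =>
    change x.symm imagRoot = imagRoot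
    rw [LinearEquiv.symm_apply_eq, hx]

lemma map_shift_zero {B : LinearMap.BilinForm ℚ V} {w : AffineSpan V ≃ₗ[ℚ] AffineSpan V}
    (hw : w ∈ affineWeylGroup P B) (k : ℤ) : w (shift 0 k) = shift 0 k := by
  rw [← smul_imagRoot, map_smul, map_imagRoot hw]

/-- Integrality of the pairing keeps the δ-coefficient of a reflected root integral, and the
generators are involutions, so their inverses need no separate treatment. -/
lemma map_mem_affineRoots [P.IsCrystallographic] {B : P.InvariantForm}
    {w : AffineSpan V ≃ₗ[ℚ] AffineSpan V} (hw : w ∈ affineWeylGroup P B.form)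
    {x : AffineSpan V} (hx : x ∈ affineRoots P) : w x ∈ affineRoots P := by
  have hrefl : ∀ s ∈ {s | ∃ a ∈ affineRoots P, ∃ ha : affineForm B.form a a ≠ 0,
      s = affineReflection B.form a ha}, ∀ x ∈ affineRoots P, s x ∈ affineRoots P := by
    rintro _ ⟨_, ⟨_, ⟨i, rfl⟩, k, rfl⟩, ha, rfl⟩ _ ⟨_, ⟨j, rfl⟩, m, rfl⟩
    exact (affineReflection_shift_root B i j k m ha).symm ▸ shift_mem_affineRoots.2 ⟨_, rfl⟩
  have hinv : ∀ s ∈ {s | ∃ a ∈ affineRoots P, ∃ ha : affineForm B.form a a ≠ 0,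
      s = affineReflection B.form a ha}, s⁻¹ = s := by
    rintro _ ⟨a, -, ha, rfl⟩
    exact LinearEquiv.ext fun x => (LinearEquiv.symm_apply_eq _).2
      (Module.involutive_reflection _ x).symm
  induction hw using Subgroup.closure_induction'' generalizing x with
  | one => exact hx
  | mem s hs => exact hrefl s hs x hx
  | inv_mem s hs => rw [hinv s hs]; exact hrefl s hs x hx
  | mul y z _ _ hy hz => exact hy (hz hx)

/-! ### Minuscule elements -/

section Minuscule

variable {b : P.Base} {w : AffineSpan V ≃ₗ[ℚ] AffineSpan V}

lemma mem_idealOf {γ : V} :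
    γ ∈ idealOf b w ↔ γ ∈ posRoots b ∧ -w (shift (-γ) 1) ∈ affinePosRoots b := by
  simp only [idealOf, inversionSet, Set.mem_ofPred_eq, imagRoot_sub_incl, Set.mem_neg]
  refine and_congr_right fun h => and_iff_right ?_
  exact shift_mem_affinePosRoots.2 (Or.inr ⟨neg_mem_roots h.1, le_rfl⟩)

/-- The shape of the positive affine roots made negative by a minuscule element. -/
lemma IsMinuscule.exists_mem_idealOf (hmin : IsMinuscule b w) {x : AffineSpan V}
    (hx : x ∈ affinePosRoots b) (hwx : -w x ∈ affinePosRoots b) :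
    ∃ γ ∈ idealOf b w, x = shift (-γ) 1 := by
  obtain ⟨I, hI, h⟩ := hmin
  have hxN : x ∈ inversionSet b w := ⟨hx, hwx⟩
  have hxN' := hxN
  rw [h] at hxN'
  obtain ⟨γ, hγ, rfl⟩ := hxN'
  exact ⟨γ, ⟨hI hγ, hxN⟩, imagRoot_sub_incl γ⟩

variable [P.IsCrystallographic] {B : P.InvariantForm}

lemma IsMinuscule.map_pos (hmin : IsMinuscule b w) (hw : w ∈ affineWeylGroup P B.form)
    {x : AffineSpan V} (hx : x ∈ affinePosRoots b)
    (h : ∀ γ ∈ idealOf b w, x ≠ shift (-γ) 1) : w x ∈ affinePosRoots b := by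
  refine (mem_affinePosRoots_or_neg_mem b
    (map_mem_affineRoots hw (affinePosRoots_subset b hx))).resolve_right fun hn => ?_
  obtain ⟨γ, hγ, rfl⟩ := hmin.exists_mem_idealOf hx hn
  exact h γ hγ rfl

lemma IsMinuscule.map_posRoot_pos (hmin : IsMinuscule b w)
    (hw : w ∈ affineWeylGroup P B.form) {ν : V} (hν : ν ∈ posRoots b) :
    w (shift ν 0) ∈ affinePosRoots b :=
  hmin.map_pos hw (shift_mem_affinePosRoots.2 (Or.inl ⟨hν, rfl⟩)) fun _ _ h => by
    have := (shift_inj.1 h).2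
    omega

lemma IsMinuscule.map_pos_of_notMem (hmin : IsMinuscule b w)
    (hw : w ∈ affineWeylGroup P B.form) {γ : V} (hγ : γ ∈ posRoots b) (h : γ ∉ idealOf b w) :
    w (shift (-γ) 1) ∈ affinePosRoots b :=
  hmin.map_pos hw (shift_mem_affinePosRoots.2 (Or.inr ⟨neg_mem_roots hγ.1, le_rfl⟩))
    fun γ' hγ' h' => h (by rwa [neg_injective (shift_inj.1 h').1])

/-- The sum 2δ - μ - ν has δ-coefficient 2, so it is not inverted. -/
lemma IsMinuscule.map_neg_sub_pos (hmin : IsMinuscule b w)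
    (hw : w ∈ affineWeylGroup P B.form) {μ ν : V} (h : μ + ν ∈ roots P) :
    w (shift (-μ) 1) + w (shift (-ν) 1) ∈ affinePosRoots b := by
  rw [← map_add, shift_add]
  refine hmin.map_pos hw (shift_mem_affinePosRoots.2 (Or.inr ⟨?_, by norm_num⟩))
    fun _ _ h => ?_
  · rw [← neg_mem_roots_iff]
    convert h using 1
    abel
  · have := (shift_inj.1 h).2
    omega

/-- The set attached to a minuscule element is an Abelian ideal. -/
lemma IsMinuscule.isAbelianIdeal (hmin : IsMinuscule b w) (hw : w ∈ affineWeylGroup P B.form) :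
    IsAbelianIdeal b (idealOf b w) where
  subset _ h := h.1
  abelian μ hμ ν hν h := by
    have h1 := hmin.map_neg_sub_pos hw h
    refine neg_notMem_affinePosRoots h1 ?_
    rw [neg_add]
    refine add_mem_affinePosRoots (mem_idealOf.1 hμ).2 (mem_idealOf.1 hν).2 ?_
    rw [← neg_add, ← map_add, ← map_neg, shift_add, neg_shift]
    refine map_mem_affineRoots hw (shift_mem_affineRoots.2 ?_)
    convert h using 1
    abel
  ideal γ hγ ν hν h := by
    refine mem_idealOf.2 ⟨add_mem_posRoots hγ.1 hν h, ?_⟩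
    have e : -w (shift (-(γ + ν)) 1) = -w (shift (-γ) 1) + w (shift ν 0) := by
      rw [← map_neg, ← map_neg, ← map_add, neg_shift, neg_shift, shift_add]
      simp
    have hr : -w (shift (-(γ + ν)) 1) ∈ affineRoots P := by
      rw [← map_neg, neg_shift]
      exact map_mem_affineRoots hw (shift_mem_affineRoots.2 (by rwa [neg_neg]))
    rw [e] at hr ⊢
    exact add_mem_affinePosRoots (mem_idealOf.1 hγ).2 (hmin.map_posRoot_pos hw hν) hr

/-- Generators of the ideal of a minuscule element are the roots `γ` for which `w (δ - γ)` is the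
negative of a simple root. -/
lemma IsMinuscule.isGenerator_iff [Finite ι] (hmin : IsMinuscule b w)
    (hB : ∀ x : V, x ≠ 0 → 0 < B.form x x) (hw : w ∈ affineWeylGroup P B.form) {θ : V}
    (hθ : IsHighestRoot b θ) {γ : V} (hγ : γ ∈ idealOf b w) :
    IsGenerator b (idealOf b w) γ ↔ -w (shift (-γ) 1) ∈ affineSimpleRoots b θ := by
  have hw' := inv_mem hw
  constructor
  · rintro ⟨-, hgen⟩
    by_contra hs
    obtain ⟨y, hy, z, hz, h⟩ :=
      exists_add_of_notMem_affineSimpleRoots B hB hθ (mem_idealOf.1 hγ).2 hs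
    obtain ⟨α, hα, k, hα'⟩ := exists_shift_of_mem_affineRoots
      (map_mem_affineRoots hw' (affinePosRoots_subset b hy))
    obtain rfl : y = w (shift α k) := by rw [← hα']; exact (w.apply_symm_apply y).symm
    rcases hz with hz | ⟨m, hm, rfl⟩
    · obtain ⟨β, hβ, m, hβ'⟩ := exists_shift_of_mem_affineRoots
        (map_mem_affineRoots hw' (affinePosRoots_subset b hz))
      obtain rfl : z = w (shift β m) := by rw [← hβ']; exact (w.apply_symm_apply z).symm
      have hsum : α + β = γ ∧ k + m = -1 := by
        rw [← map_neg, ← map_add, w.injective.eq_iff, neg_shift, shift_add, shift_inj] at h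
        exact ⟨by rw [← h.1, neg_neg], h.2.symm⟩
      -- A summand with negative preimage must be γ₁ - δ with γ₁ in the ideal. The other then has
      -- level 0 and is a positive root β with γ - β = γ₁, contradicting that γ is a generator.
      have key : ∀ α ∈ roots P, ∀ β ∈ roots P, ∀ k m : ℤ, w (shift α k) ∈ affinePosRoots b →
          w (shift β m) ∈ affinePosRoots b → α + β = γ → k + m = -1 →
          -shift α k ∉ affinePosRoots b := by
        intro α hα β hβ k m hy hz hv hkm hn
        obtain ⟨γ₁, hγ₁, e⟩ := hmin.exists_mem_idealOf hn (by rwa [map_neg, neg_neg])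
        rw [neg_shift, shift_inj, neg_inj] at e
        obtain ⟨rfl, hk⟩ := e
        obtain rfl : m = 0 := by omega
        rcases mem_posRoots_or_neg_mem b hβ with hp | hp
        · exact hgen β hp (by rwa [← hv, add_sub_cancel_right])
        · refine neg_notMem_affinePosRoots hz ?_
          have := hmin.map_posRoot_pos hw hp
          rwa [← map_neg, neg_shift, neg_zero]
      have h1 := key α hα β hβ k m hy hz hsum.1 hsum.2
      have h2 := key β hβ α hα m k hz hy (by rw [add_comm]; exact hsum.1) (by omega)
      have h3 := (mem_affinePosRoots_or_neg_mem b
        (shift_mem_affineRoots.2 hα)).resolve_right h1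
      have h4 := (mem_affinePosRoots_or_neg_mem b
        (shift_mem_affineRoots.2 hβ)).resolve_right h2
      -- Both preimages are positive, yet their levels add up to -1.
      rw [shift_mem_affinePosRoots] at h3 h4
      omega
    · rw [← map_shift_zero hw m, ← map_neg, ← map_add, w.injective.eq_iff, neg_shift, shift_add,
        shift_inj, neg_neg, add_zero] at h
      obtain ⟨rfl, hk⟩ := h
      -- Now k = -1 - m ≤ -2, so an inverted root would have level at least 2.
      have hn : -shift γ k ∈ affinePosRoots b := by
        rw [neg_shift]
        exact shift_mem_affinePosRoots.2 (Or.inr ⟨neg_mem_roots hα, by omega⟩)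
      obtain ⟨γ₁, -, e⟩ := hmin.exists_mem_idealOf hn (by rwa [map_neg, neg_neg])
      rw [neg_shift, shift_inj] at e
      omega
  · refine fun hs => ⟨hγ, fun α hα h => ?_⟩
    -- The splitting is -w(δ - γ) = -w(δ - (γ - α)) + w(α).
    refine add_notMem_affineSimpleRoots hθ (mem_idealOf.1 h).2 (hmin.map_posRoot_pos hw hα) ?_
    rw [← map_neg, ← map_add, neg_shift, shift_add]
    rw [← map_neg, neg_shift] at hs
    simpa using hs

/-- The roots `γ` extending the ideal of a minuscule element to a larger Abelian ideal are those
for which `w (δ - γ)` is a simple root. -/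
lemma IsMinuscule.isAbelianIdeal_union_iff [Finite ι] [P.IsReduced] (hmin : IsMinuscule b w)
    (hB : ∀ x : V, x ≠ 0 → 0 < B.form x x) (hw : w ∈ affineWeylGroup P B.form) {θ : V}
    (hθ : IsHighestRoot b θ) {γ : V} (hγ : γ ∈ posRoots b) (hγI : γ ∉ idealOf b w) :
    IsAbelianIdeal b (idealOf b w ∪ {γ}) ↔ w (shift (-γ) 1) ∈ affineSimpleRoots b θ := by
  have hw' := inv_mem hw
  have hpos := hmin.map_pos_of_notMem hw hγ hγI
  constructor
  · intro hI
    by_contra hs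
    obtain ⟨y, hy, z, hz, h⟩ := exists_add_of_notMem_affineSimpleRoots B hB hθ hpos hs
    obtain ⟨α, hα, k, hα'⟩ := exists_shift_of_mem_affineRoots
      (map_mem_affineRoots hw' (affinePosRoots_subset b hy))
    obtain rfl : y = w (shift α k) := by rw [← hα']; exact (w.apply_symm_apply y).symm
    rcases hz with hz | ⟨m, hm, rfl⟩
    · obtain ⟨β, hβ, m, hβ'⟩ := exists_shift_of_mem_affineRoots
        (map_mem_affineRoots hw' (affinePosRoots_subset b hz))
      obtain rfl : z = w (shift β m) := by rw [← hβ']; exact (w.apply_symm_apply z).symm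
      have hsum : α + β = -γ ∧ k + m = 1 := by
        rw [← map_add, w.injective.eq_iff, shift_add, shift_inj] at h
        exact ⟨h.1.symm, h.2.symm⟩
      -- A negative preimage would put α in the ideal, and α + γ = -β would be a root, against the
      -- Abelian condition.
      have hnn : ∀ α ∈ roots P, ∀ β ∈ roots P, ∀ k : ℤ, w (shift α k) ∈ affinePosRoots b →
          α + β = -γ → shift α k ∈ affinePosRoots b := by
        intro α hα β hβ k hy hv
        refine (mem_affinePosRoots_or_neg_mem b
          (shift_mem_affineRoots.2 hα)).resolve_right fun hn => ?_
        obtain ⟨γ₁, hγ₁, e⟩ := hmin.exists_mem_idealOf hn (by rwa [map_neg, neg_neg])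
        rw [neg_shift, shift_inj, neg_inj] at e
        obtain ⟨rfl, -⟩ := e
        refine hI.abelian α (Or.inl hγ₁) γ (Or.inr rfl) ?_
        rw [← neg_mem_roots_iff]
        rwa [show -(α + γ) = β by rw [neg_add, ← hv]; abel]
      -- At level 1 the second summand is δ - (γ + α); the ideal condition puts γ + α in the ideal,
      -- so its image is negative.
      have hone : ∀ α ∈ roots P, ∀ β ∈ roots P, ∀ m : ℤ, w (shift β m) ∈ affinePosRoots b →
          α + β = -γ → α ∈ posRoots b → m ≠ 1 := by
        rintro α hα β hβ _ hz hv hα' rfl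
        have hβ' : β = -(γ + α) := by rw [neg_add, ← hv]; abel
        subst hβ'
        rcases hI.ideal γ (Or.inr rfl) α hα' (neg_mem_roots_iff.1 hβ) with h | h
        · exact neg_notMem_affinePosRoots hz (mem_idealOf.1 h).2
        · exact ne_zero_of_mem_roots hα (by simpa using h)
      have h1 := hnn α hα β hβ k hy hsum.1
      have h2 := hnn β hβ α hα m hz (by rw [add_comm]; exact hsum.1)
      rw [shift_mem_affinePosRoots] at h1 h2
      rcases h1 with ⟨h1, hk⟩ | ⟨-, hk⟩
      · exact hone α hα β hβ m hz hsum.1 h1 (by omega)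
      · rcases h2 with ⟨h2, hm⟩ | ⟨-, hm⟩
        · exact hone β hβ α hα k hy (by rw [add_comm]; exact hsum.1) h2 (by omega)
        · omega
    · rw [← map_shift_zero hw m, ← map_add, w.injective.eq_iff, shift_add, shift_inj,
        add_zero] at h
      obtain ⟨rfl, hk⟩ := h
      -- Here k = 1 - m, so γ + (m - 1)δ is inverted, forcing -γ to be a positive root.
      have hn : -shift (-γ) k ∈ affinePosRoots b := by
        rw [neg_shift, neg_neg, shift_mem_affinePosRoots]
        rcases hm.eq_or_lt with rfl | hm
        · exact Or.inl ⟨hγ, by omega⟩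
        · exact Or.inr ⟨hγ.1, by omega⟩
      obtain ⟨γ₁, hγ₁, e⟩ := hmin.exists_mem_idealOf hn (by rwa [map_neg, neg_neg])
      rw [neg_shift, shift_inj, neg_neg] at e
      exact neg_notMem_posRoots hγ₁.1 (e.1 ▸ hγ)
  · intro hs
    have hI := hmin.isAbelianIdeal hw
    have hab : ∀ μ ∈ idealOf b w, γ + μ ∉ roots P := by
      intro μ hμ h
      -- The splitting is w(δ - γ) = w(2δ - γ - μ) + (-w(δ - μ)).
      refine add_notMem_affineSimpleRoots hθ (hmin.map_neg_sub_pos hw h) (mem_idealOf.1 hμ).2 ?_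
      rwa [add_neg_cancel_right]
    refine ⟨Set.union_subset hI.subset (Set.singleton_subset_iff.2 hγ), ?_, ?_⟩
    · rintro μ (hμ | rfl) ν (hν | rfl)
      · exact hI.abelian μ hμ ν hν
      · rw [add_comm]
        exact hab μ hμ
      · exact hab ν hν
      · have : IsAddTorsionFree V := .of_module_rat V
        obtain ⟨i, rfl⟩ := hγ.1
        rw [← two_nsmul]
        exact P.nsmul_notMem_range_root
    · rintro μ (hμ | rfl) ν hν h
      · exact Or.inl (hI.ideal μ hμ ν hν h)
      · by_contra hc
        have hp := hmin.map_pos_of_notMem hw (add_mem_posRoots hγ hν h) fun h' => hc (Or.inl h')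
        -- The splitting is w(δ - γ) = w(δ - (γ + ν)) + w(ν).
        refine add_notMem_affineSimpleRoots hθ hp (hmin.map_posRoot_pos hw hν) ?_
        rw [← map_add, shift_add]
        simpa using hs

end Minuscule

end AffineRoots

end

theorem mainTheorem12 {ι V N : Type*} [Finite ι]
    [AddCommGroup V] [Module ℚ V] [AddCommGroup N] [Module ℚ N]
    (P : RootPairing ι ℚ V N) [P.IsRootSystem] [P.IsCrystallographic] [P.IsReduced]
    [P.IsIrreducible] (b : P.Base)
    (B : P.InvariantForm) (hB : ∀ x : V, x ≠ 0 → 0 < B.form x x)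
    (θ : V) (hθ : AffineRoots.IsHighestRoot b θ)
    (w : AffineRoots.AffineSpan V ≃ₗ[ℚ] AffineRoots.AffineSpan V)
    (hw : w ∈ AffineRoots.affineWeylGroup P B.form) (hmin : AffineRoots.IsMinuscule b w) :
    (∀ γ ∈ AffineRoots.idealOf b w,
      (AffineRoots.IsGenerator b (AffineRoots.idealOf b w) γ ↔
        w (AffineRoots.imagRoot - AffineRoots.incl γ) ∈
          -AffineRoots.affineSimpleRoots b θ)) ∧
    (∀ γ ∈ AffineRoots.posRoots b \ AffineRoots.idealOf b w,
      (AffineRoots.IsAbelianIdeal b (AffineRoots.idealOf b w ∪ {γ}) ↔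
        w (AffineRoots.imagRoot - AffineRoots.incl γ) ∈
          AffineRoots.affineSimpleRoots b θ)) := by
  refine ⟨fun γ hγ => ?_, fun γ hγ => ?_⟩
  · rw [AffineRoots.imagRoot_sub_incl, Set.mem_neg]
    exact hmin.isGenerator_iff hB hw hθ hγ
  · rw [AffineRoots.imagRoot_sub_incl]
    exact hmin.isAbelianIdeal_union_iff hB hw hθ hγ.1 hγ.2
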